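/- A lattice polygon is the convex hull of finitely many points of $\mathbb{Z}^2\subset\mathbb{R}^2$ (so segments and single points are allowed). The normal fan of a lattice polygon $P$ is the collection of the cones $N_P(F)=\{u\in\mathbb{R}^2 : \langle u,y\rangle\le\langle u,x\rangle \text{ for all } x\in F,\ y\in P\}$, where $F$ runs over the nonempty faces of $P$ (including $P$ itself). A fan $\Sigma'$ coarsens a fan $\Sigma$ if the two have the same support and every cone of $\Sigma$ is contained in a cone of $\Sigma'$. Theorem. Let $P$ and $Q$ be lattice polygons in $\mathbb{R}^2$ such that the normal fan of $Q$ coarsens the normal fan of $P$. Then every lattice point of $P+Q=\{x+y : x\in P,\ y\in Q\}$ is the sum of a lattice point of $P$ and a lattice point of $Q$; that is, $$(P\cap\mathbb{Z}^2)+(Q\cap\mathbb{Z}^2)=(P+Q)\cap\mathbb{Z}^2 .$$ -/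

import Mathlib

open scoped Pointwise

/-- The lattice `ℤ²` inside `ℝ²`. -/
def integerLattice : Set (Fin 2 → ℝ) :=
  Set.range fun (z : Fin 2 → ℤ) (i : Fin 2) => (z i : ℝ)

/-- A lattice polygon: the convex hull of finitely many points of `ℤ²`
(segments and single points are allowed). -/
def IsLatticePolygon (P : Set (Fin 2 → ℝ)) : Prop :=
  ∃ V : Set (Fin 2 → ℝ), V.Finite ∧ V ⊆ integerLattice ∧ P = convexHull ℝ V

/-- The (outer) normal cone of `P` along `F ⊆ P`: all `u` such that the linear functional
`x ↦ u ⬝ᵥ x` attains its maximum over `P` at every point of `F`. -/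
def normalCone (P F : Set (Fin 2 → ℝ)) : Set (Fin 2 → ℝ) :=
  {u | ∀ x ∈ F, ∀ y ∈ P, u ⬝ᵥ y ≤ u ⬝ᵥ x}

/-- The normal fan of a polytope `P`: the collection of the normal cones of its nonempty faces
(all faces of a polytope, including the polytope itself, are exposed). -/
def normalFan (P : Set (Fin 2 → ℝ)) : Set (Set (Fin 2 → ℝ)) :=
  {C | ∃ F : Set (Fin 2 → ℝ), F.Nonempty ∧ IsExposed ℝ P F ∧ C = normalCone P F}

/-- `FanCoarsens S T`: the fan `S` coarsens the fan `T` (equivalently, `T` is a subdivision, or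
refinement, of `S`): both have the same support, and every cone of `T` lies in a cone of `S`. -/
def FanCoarsens (S T : Set (Set (Fin 2 → ℝ))) : Prop :=
  ⋃₀ S = ⋃₀ T ∧ ∀ C ∈ T, ∃ D ∈ S, C ⊆ D

/-! Let `z` be a lattice point of `P + Q` and put `R = z - P`. Then `R` meets `Q`, and `z`
decomposes exactly when `R ∩ Q` contains a lattice point. Suppose it contains none. The segment from
a point of `R ∩ Q` to a lattice point `a` of `R` leaves `Q` inside an edge (`exists_edge`), hence
inside a primitive lattice segment `[c, c + v]` of that edge. Since `c` and `c + v` are not in `R`,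
the set `R` is pinched between them on that line. The fan hypothesis gives `P` an edge with the same
outer normal (`FanCoarsens.exists_ne_vertices`), so `R` contains a lattice translate of `[c, c +
v]`, strictly on the side of `Q`. This is a `Cut` with `a` beyond it (`exists_cut`).

Two facts make this impossible. No lattice triangle in `R` has all three sides meeting `Q`
(`false_of_triangle`): an extra lattice point yields a smaller such triangle, and a unimodular one
is excluded by a cut at a vertex. Nor can two cuts have their translated edges beyond each other
(`Cut.false_of_two`), by comparing widths. In `false_of_cuts`, one cut has `a` beyond it and a
second has beyond it an end `s₁` of the first translated edge. By the triangle fact every lattice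
point of `R` is beyond one of the two, which puts the translated edges beyond each other. -/

/-! ### Lattice points, determinants and weighted means -/

/-- The lattice point with integer coordinates `z`. -/
def latticePoint (z : Fin 2 → ℤ) : Fin 2 → ℝ := fun i => (z i : ℝ)

/-- The determinant of two plane vectors. -/
def cross {K : Type*} [CommRing K] (x y : Fin 2 → K) : K := x 0 * y 1 - x 1 * y 0

theorem latticePoint_apply (z : Fin 2 → ℤ) (i : Fin 2) : latticePoint z i = (z i : ℝ) := rfl

theorem cross_latticePoint (x y : Fin 2 → ℤ) :
    cross (latticePoint x) (latticePoint y) = (cross x y : ℤ) := by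
  simp [cross, latticePoint]

theorem latticePoint_add (x y : Fin 2 → ℤ) :
    latticePoint (x + y) = latticePoint x + latticePoint y := by
  ext i; simp [latticePoint]

theorem latticePoint_sub (x y : Fin 2 → ℤ) :
    latticePoint (x - y) = latticePoint x - latticePoint y := by
  ext i; simp [latticePoint]

theorem latticePoint_injective : Function.Injective latticePoint := by
  intro x y h
  ext i
  have := congrFun h i
  simpa [latticePoint] using this

/-- Unnormalised weights reduce a membership to two coordinate identities without a common
denominator. -/
theorem Convex.mem_of_weights {S : Set (Fin 2 → ℝ)} (hS : Convex ℝ S) {x y z w : Fin 2 → ℝ}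
    (hx : x ∈ S) (hy : y ∈ S) (hz : z ∈ S) {p q r : ℝ} (hp : 0 ≤ p) (hq : 0 ≤ q) (hr : 0 ≤ r)
    (hpos : 0 < p + q + r) (h0 : (p + q + r) * w 0 = p * x 0 + q * y 0 + r * z 0)
    (h1 : (p + q + r) * w 1 = p * x 1 + q * y 1 + r * z 1) : w ∈ S := by
  have key := hS.sum_mem (t := Finset.univ) (w := ![p / (p + q + r), q / (p + q + r),
    r / (p + q + r)]) (z := ![x, y, z])
    (by intro i _; fin_cases i <;> simp <;> positivity)
    (by simp [Fin.sum_univ_three]; field_simp)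
    (by intro i _; fin_cases i <;> simp [hx, hy, hz])
  convert key using 1
  ext i
  fin_cases i
  · simp [Fin.sum_univ_three]; field_simp; linarith
  · simp [Fin.sum_univ_three]; field_simp; linarith

theorem Convex.mem_of_two_weights {S : Set (Fin 2 → ℝ)} (hS : Convex ℝ S) {x y w : Fin 2 → ℝ}
    (hx : x ∈ S) (hy : y ∈ S) {p q : ℝ} (hp : 0 ≤ p) (hq : 0 ≤ q)
    (hpos : 0 < p + q) (h0 : (p + q) * w 0 = p * x 0 + q * y 0)
    (h1 : (p + q) * w 1 = p * x 1 + q * y 1) : w ∈ S :=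
  hS.mem_of_weights hx hy hy hp hq le_rfl (by linarith) (by linarith) (by linarith)

/-! ### Cuts -/

/-- The edge `[c, c + v]` of `Q` cuts `R`: the line through it supports `Q` and meets `R` only
between `c` and `c + v`, and `R` contains a translate of the edge on the side of `Q`. -/
structure Cut (R Q : Set (Fin 2 → ℝ)) (c v : Fin 2 → ℤ) : Prop where
  left_mem : latticePoint c ∈ Q
  right_mem : latticePoint (c + v) ∈ Q
  support : ∀ y ∈ Q, cross (latticePoint v) (y - latticePoint c) ≤ 0
  chord : ∀ y ∈ R, cross (latticePoint v) (y - latticePoint c) = 0 →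
    ∃ θ : ℝ, 0 < θ ∧ θ < 1 ∧ y = latticePoint c + θ • latticePoint v
  translate : ∃ s : Fin 2 → ℤ, latticePoint s ∈ R ∧ latticePoint (s + v) ∈ R ∧
    cross (latticePoint v) (latticePoint s - latticePoint c) < 0

section Cuts

variable {R Q : Set (Fin 2 → ℝ)}

theorem Cut.mem_of_chord {c v : Fin 2 → ℤ} (h : Cut R Q c v) (hQ : Convex ℝ Q) {θ : ℝ} (h0 : 0 < θ)
    (h1 : θ < 1) : latticePoint c + θ • latticePoint v ∈ Q :=
  hQ.mem_of_two_weights h.left_mem h.right_mem (p := 1 - θ) (q := θ) (by linarith) h0.le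
    (by linarith) (by simp [latticePoint_add]; ring) (by simp [latticePoint_add]; ring)

/-- If `b` lies on the side of `Q` of a cut and `a` beyond it, then `[a, b]` meets `Q`. -/
theorem Cut.exists_mem {c v : Fin 2 → ℤ} (h : Cut R Q c v) (hR : Convex ℝ R) {a b : Fin 2 → ℝ}
    (ha : a ∈ R) (hb : b ∈ R) (hca : 0 < cross (latticePoint v) (a - latticePoint c))
    (hcb : cross (latticePoint v) (b - latticePoint c) ≤ 0) :
    ∃ t θ : ℝ, 0 < t ∧ t ≤ 1 ∧ 0 < θ ∧ θ < 1 ∧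
      t * (cross (latticePoint v) (a - latticePoint c) -
        cross (latticePoint v) (b - latticePoint c)) =
          cross (latticePoint v) (a - latticePoint c) ∧
      a + t • (b - a) = latticePoint c + θ • latticePoint v := by
  set A := cross (latticePoint v) (a - latticePoint c) with hA
  set B := cross (latticePoint v) (b - latticePoint c) with hB
  have hAB : 0 < A - B := by linarith
  have ht : A / (A - B) * (A - B) = A := by field_simp
  have ht0 : 0 < A / (A - B) := by positivity
  have ht1 : A / (A - B) ≤ 1 := by rw [div_le_one hAB]; linarith
  obtain ⟨θ, h0, h1, h2⟩ := h.chord (a + (A / (A - B)) • (b - a))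
    (hR.mem_of_two_weights ha hb (p := 1 - A / (A - B)) (q := A / (A - B)) (by linarith) ht0.le
      (by linarith) (by simp; ring) (by simp; ring)) (by
        have : cross (latticePoint v) (a + (A / (A - B)) • (b - a) - latticePoint c)
          = A + (A / (A - B)) * (B - A) := by
          simp only [hA, hB]
          generalize cross (latticePoint v) (a - latticePoint c) /
            (cross (latticePoint v) (a - latticePoint c) -
             cross (latticePoint v) (b - latticePoint c)) = t
          simp [cross]; ring
        rw [this]; linarith)
  exact ⟨_, θ, ht0, ht1, h0, h1, ht, h2⟩

/-- If the segment `[a, b]` meets `Q` and `a` is beyond a cut, then `b` is not. -/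
theorem Cut.le_of_mem {c v : Fin 2 → ℤ} (h : Cut R Q c v) {a b x : Fin 2 → ℝ}
    (hx : x ∈ segment ℝ a b) (hxQ : x ∈ Q)
    (hca : 0 < cross (latticePoint v) (a - latticePoint c)) :
    cross (latticePoint v) (b - latticePoint c) ≤ 0 := by
  obtain ⟨p, q, hp, hq, hpq, rfl⟩ := hx
  have h1 := h.support _ hxQ
  have h2 : cross (latticePoint v) (p • a + q • b - latticePoint c) =
      p * cross (latticePoint v) (a - latticePoint c) +
      q * cross (latticePoint v) (b - latticePoint c) := by
    obtain rfl : p = 1 - q := by linarith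
    simp [cross]; ring
  rw [h2] at h1
  by_contra hcon
  push Not at hcon
  rcases hp.eq_or_lt with rfl | hp'
  · obtain rfl : q = 1 := by linarith
    linarith
  · nlinarith [mul_pos hp' hca, mul_nonneg hq hcon.le]

/-! ### Two cuts facing each other -/

/-- The segments `[r, s]` and `[r + u, s + v]` cross the line `c + ℝ v` less than one `v` apart.
This displacement interpolates between `v` at the lower ends and `u` at the upper ends. Keeping it
below one therefore bounds `u` by `v`, both measured against `r - s`. -/
theorem cross_lt_of_chord {v u r s c : Fin 2 → ℝ} {t t' θ θ' : ℝ}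
    (hr : 0 < cross v (r - c)) (hr' : 0 < cross v (r + u - c)) (hs : cross v (s - c) < 0)
    (hθ : 0 < θ) (hθ' : θ' < 1)
    (ht : t * (cross v (r - c) - cross v (s - c)) = cross v (r - c))
    (ht' : t' * (cross v (r + u - c) - cross v (s + v - c)) = cross v (r + u - c))
    (hX : r + t • (s - r) = c + θ • v)
    (hX' : (r + u) + t' • ((s + v) - (r + u)) = c + θ' • v) :
    cross u (r - s) < cross v (r - s) := by
  -- The factor of `v i` is the equation for `θ' - θ` with `t` and `t'` eliminated; since `v ≠ 0`,
  -- it vanishes.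
  have comp : ∀ i, (cross v (r - s) * (cross v (r - s) + cross v u) * (θ' - θ) -
      cross v (s - c) * cross u (s - r) - cross v (r - s) * cross v (r + u - c)) * v i = 0 := by
    intro i
    have e := congrFun hX i
    have e' := congrFun hX' i
    simp only [cross, Pi.add_apply, Pi.sub_apply, Pi.smul_apply, smul_eq_mul] at ht ht' e e' ⊢
    fin_cases i
    · simp only [Fin.zero_eta] at e e' ⊢
      linear_combination
        (-(v 0 * (r 1 - s 1) - v 1 * (r 0 - s 0)) *
          (v 0 * (r 1 - s 1) - v 1 * (r 0 - s 0) + (v 0 * u 1 - v 1 * u 0))) * (e' - e)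
        + (v 0 * (r 1 - s 1) - v 1 * (r 0 - s 0)) * (s 0 + v 0 - r 0 - u 0) * ht'
        - (v 0 * (r 1 - s 1) - v 1 * (r 0 - s 0) + (v 0 * u 1 - v 1 * u 0)) * (s 0 - r 0) * ht
    · simp only [Fin.mk_one] at e e' ⊢
      linear_combination
        (-(v 0 * (r 1 - s 1) - v 1 * (r 0 - s 0)) *
          (v 0 * (r 1 - s 1) - v 1 * (r 0 - s 0) + (v 0 * u 1 - v 1 * u 0))) * (e' - e)
        + (v 0 * (r 1 - s 1) - v 1 * (r 0 - s 0)) * (s 1 + v 1 - r 1 - u 1) * ht'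
        - (v 0 * (r 1 - s 1) - v 1 * (r 0 - s 0) + (v 0 * u 1 - v 1 * u 0)) * (s 1 - r 1) * ht
  have hv : v 0 ≠ 0 ∨ v 1 ≠ 0 := by
    by_contra hcon
    push Not at hcon
    simp [cross, hcon.1, hcon.2] at hr
  have K : cross v (r - s) * (cross v (r - s) + cross v u) * (θ' - θ) -
      cross v (s - c) * cross u (s - r) - cross v (r - s) * cross v (r + u - c) = 0 := by
    rcases hv with hv | hv
    · exact (mul_eq_zero.1 (comp 0)).resolve_right hv
    · exact (mul_eq_zero.1 (comp 1)).resolve_right hv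
  have e1 : cross v (r - s) = cross v (r - c) - cross v (s - c) := by simp [cross]; ring
  have e2 : cross v (r + u - c) = cross v (r - c) + cross v u := by simp [cross]; ring
  have e3 : cross u (r - s) = - cross u (s - r) := by simp [cross]; ring
  rw [e3, e1]
  rw [e1] at K
  rw [e2] at K hr'
  generalize cross v (r - c) = a at *
  generalize cross v (s - c) = b at *
  generalize cross v u = d at *
  generalize cross u (s - r) = f at *
  have hp : 0 < (a - b) * (a - b + d) := mul_pos (by linarith) (by linarith)
  have h1 : (a - b) * (a - b + d) * (θ' - θ) < (a - b) * (a - b + d) * 1 :=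
    mul_lt_mul_of_pos_left (by linarith) hp
  have h2 : -b * -f < -b * (a - b) := by nlinarith
  exact lt_of_mul_lt_mul_left h2 (by linarith)

/-- Two cuts whose translated edges lie beyond each other are impossible. -/
theorem Cut.false_of_two {c₁ v₁ c₂ v₂ s₁ s₂ : Fin 2 → ℤ} (h₁ : Cut R Q c₁ v₁) (h₂ : Cut R Q c₂ v₂)
    (hR : Convex ℝ R) (hs₁ : latticePoint s₁ ∈ R) (hs₁' : latticePoint (s₁ + v₁) ∈ R)
    (hs₂ : latticePoint s₂ ∈ R) (hs₂' : latticePoint (s₂ + v₂) ∈ R)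
    (n₁ : cross (latticePoint v₁) (latticePoint s₁ - latticePoint c₁) < 0)
    (n₂ : cross (latticePoint v₂) (latticePoint s₂ - latticePoint c₂) < 0)
    (p₁ : 0 < cross (latticePoint v₁) (latticePoint s₂ - latticePoint c₁))
    (p₁' : 0 < cross (latticePoint v₁) (latticePoint (s₂ + v₂) - latticePoint c₁))
    (p₂ : 0 < cross (latticePoint v₂) (latticePoint s₁ - latticePoint c₂))
    (p₂' : 0 < cross (latticePoint v₂) (latticePoint (s₁ + v₁) - latticePoint c₂)) : False := by
  -- Each cut bounds the edge beyond it by its own edge. Exchanging the roles gives the reverse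
  -- inequality, and the two add up to `0 < 0`.
  have main : ∀ {c₁ v₁ v₂ s₁ s₂ : Fin 2 → ℤ}, Cut R Q c₁ v₁ →
      latticePoint s₁ ∈ R → latticePoint (s₁ + v₁) ∈ R →
      latticePoint s₂ ∈ R → latticePoint (s₂ + v₂) ∈ R →
      cross (latticePoint v₁) (latticePoint s₁ - latticePoint c₁) < 0 →
      0 < cross (latticePoint v₁) (latticePoint s₂ - latticePoint c₁) →
      0 < cross (latticePoint v₁) (latticePoint (s₂ + v₂) - latticePoint c₁) →
      cross (latticePoint v₂) (latticePoint s₁ - latticePoint s₂) <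
        cross (latticePoint v₁) (latticePoint s₂ - latticePoint s₁) +
          cross (latticePoint v₁) (latticePoint v₂) := by
    intro c v w s r h hs hs' hr hr' n p p'
    have n' : cross (latticePoint v) (latticePoint (s + v) - latticePoint c) < 0 := by
      have : cross (latticePoint v) (latticePoint (s + v) - latticePoint c) =
        cross (latticePoint v) (latticePoint s - latticePoint c) := by
        simp [cross, latticePoint_add]; ring
      rwa [this]
    obtain ⟨t, θ, -, -, hθ, -, ht, hX⟩ := h.exists_mem hR hr' hs p' n.le
    obtain ⟨t', θ', -, -, -, hθ', ht', hX'⟩ := h.exists_mem hR hr hs' p n'.le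
    -- The edge beyond the cut is traversed backwards, from `r + w` by `-w`.
    have er : latticePoint r = latticePoint (r + w) + -latticePoint w := by
      rw [latticePoint_add]; simp
    rw [er] at p ht' hX'
    rw [latticePoint_add s v] at ht' hX'
    have := cross_lt_of_chord p' p n hθ hθ' ht ht' hX hX'
    simp only [latticePoint_add] at this
    simp only [cross, Pi.add_apply, Pi.sub_apply, Pi.neg_apply] at this ⊢
    linarith
  have a := main h₁ hs₁ hs₁' hs₂ hs₂' n₁ p₁ p₁'
  have b := main h₂ hs₂ hs₂' hs₁ hs₁' n₂ p₂ p₂'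
  simp only [cross, Pi.sub_apply] at a b
  linarith

/-! ### Triangles whose sides meet `Q` -/

/-- A lattice point of `Q` beyond one side of a unimodular triangle avoiding it lies on the inner
side of the two others. -/
theorem corner_le {a b d c : Fin 2 → ℤ} (hQ : Convex ℝ Q)
    (hδ : cross (b - a) (d - a) * cross (b - a) (d - a) = 1) (hb : latticePoint b ∉ Q)
    {μ ν : ℝ} (hμ : 0 < μ) (hν : ν < 1) (hc : latticePoint c ∈ Q)
    (hm : latticePoint b + μ • (latticePoint d - latticePoint b) ∈ Q)
    (hn : latticePoint a + ν • (latticePoint b - latticePoint a) ∈ Q)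
    (hy : cross (b - a) (d - a) * cross (b - a) (c - a) < 0) :
    cross (b - a) (d - a) * cross (c - a) (d - a) +
      cross (b - a) (d - a) * cross (b - a) (c - a) ≤ 0 := by
  by_contra hcon
  set x := cross (b - a) (d - a) * cross (c - a) (d - a) with hx
  set y := cross (b - a) (d - a) * cross (b - a) (c - a) with hy'
  -- Here `x`, `y` are the coordinates of `c` in the lattice basis `b - a`, `d - a`. Integrality
  -- places `c` on or beyond the line `bd`, where `x + y = 1`.
  have hxy : 1 ≤ x + y := by omega
  have hc' : ∀ i, c i = a i + x * (b i - a i) + y * (d i - a i) := by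
    intro i
    rw [hx, hy']
    fin_cases i <;> simp [cross] at hδ ⊢
    · linear_combination (-(c 0 - a 0)) * hδ
    · linear_combination (-(c 1 - a 1)) * hδ
  have hcr : ∀ i, (c i : ℝ) = a i + x * (b i - a i) + y * (d i - a i) := by
    intro i; exact_mod_cast hc' i
  have hyr : (y : ℝ) < 0 := by exact_mod_cast hy
  have hxyr : (1 : ℝ) ≤ x + y := by exact_mod_cast hxy
  have hν' : 0 < 1 - ν := by linarith
  -- The weight on `bd` cancels the negative coordinate `y` of `c`, and the weight on `ab` then
  -- brings the mean back to `b`.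
  refine hb (hQ.mem_of_weights hc hm hn (p := 1) (q := -y / μ) (r := (x + y - 1) / (1 - ν))
    zero_le_one (div_nonneg (by linarith) hμ.le) (div_nonneg (by linarith) hν'.le) ?_ ?_ ?_)
  · have := div_nonneg (by linarith : (0:ℝ) ≤ -y) hμ.le
    have := div_nonneg (by linarith : (0:ℝ) ≤ x + y - 1) hν'.le
    linarith
  · simp only [latticePoint_apply, Pi.add_apply, Pi.smul_apply, Pi.sub_apply, smul_eq_mul, hcr]
    field_simp
    ring
  · simp only [latticePoint_apply, Pi.add_apply, Pi.smul_apply, Pi.sub_apply, smul_eq_mul, hcr]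
    field_simp
    ring

/-- A unimodular triangle with vertices outside `Q` and all sides meeting `Q` has no vertex which
is separated from the two others by a cut. -/
theorem Cut.false_of_unimodular {a b d c v : Fin 2 → ℤ} (h : Cut R Q c v) (hR : Convex ℝ R)
    (hQ : Convex ℝ Q) (hδ : cross (b - a) (d - a) * cross (b - a) (d - a) = 1)
    (haR : latticePoint a ∈ R) (hbR : latticePoint b ∈ R) (hdR : latticePoint d ∈ R)
    (hb : latticePoint b ∉ Q) (hd : latticePoint d ∉ Q)
    (hbd : (segment ℝ (latticePoint b) (latticePoint d) ∩ Q).Nonempty)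
    (ha : 0 < cross (latticePoint v) (latticePoint a - latticePoint c))
    (hcb : cross (latticePoint v) (latticePoint b - latticePoint c) ≤ 0)
    (hcd : cross (latticePoint v) (latticePoint d - latticePoint c) ≤ 0) : False := by
  obtain ⟨t, θ, ht, ht1, hθ, hθ1, -, hX⟩ := h.exists_mem hR haR hbR ha hcb
  obtain ⟨t', φ, ht', ht1', hφ, hφ1, -, hY⟩ := h.exists_mem hR haR hdR ha hcd
  have hXQ := h.mem_of_chord hQ hθ hθ1
  have hYQ := h.mem_of_chord hQ hφ hφ1
  rw [← hX] at hXQ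
  rw [← hY] at hYQ
  have ht1 : t < 1 := by
    refine ht1.lt_of_ne fun e => hb ?_
    simpa [e] using hXQ
  have ht1' : t' < 1 := by
    refine ht1'.lt_of_ne fun e => hd ?_
    simpa [e] using hYQ
  obtain ⟨m, hm, hmQ⟩ := hbd
  rw [segment_eq_image'] at hm
  obtain ⟨μ, ⟨hμ, hμ1⟩, rfl⟩ := hm
  dsimp only at hmQ
  have hμ : 0 < μ := by
    refine hμ.lt_of_ne fun e => hb ?_
    simpa [← e] using hmQ
  have hμ1 : μ < 1 := by
    refine hμ1.lt_of_ne fun e => hd ?_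
    simpa [e] using hmQ
  have hmQ' : latticePoint d + (1 - μ) • (latticePoint b - latticePoint d) ∈ Q := by
    convert hmQ using 1
    ext i; simp; ring
  have corner : ∀ q : Fin 2 → ℤ, latticePoint q ∈ Q →
      (cross (b - a) (d - a) * cross (b - a) (q - a) < 0 ∨
        cross (b - a) (d - a) * cross (q - a) (d - a) < 0) →
      cross (b - a) (d - a) * cross (q - a) (d - a) +
        cross (b - a) (d - a) * cross (b - a) (q - a) ≤ 0 := by
    rintro q hq (hy | hx)
    · exact corner_le hQ hδ hb hμ ht1 hq hmQ hXQ hy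
    · have sw : ∀ x y : Fin 2 → ℤ, cross x y = - cross y x := by
        intro x y; simp [cross]; ring
      have := corner_le (a := a) (b := d) (d := b) (c := q) hQ
        (by rw [sw]; linarith) hd (μ := 1 - μ) (by linarith) ht1' hq hmQ' hYQ
        (by rw [sw (d - a) (b - a), sw (d - a) (q - a)]; linarith)
      rw [sw (d - a) (b - a), sw (d - a) (q - a), sw (q - a) (b - a)] at this
      linarith
  have cc := corner c h.left_mem
  have cd := corner (c + v) h.right_mem
  have ex : cross (b - a) (d - a) * cross (c + v - a) (d - a) =
      cross (b - a) (d - a) * cross (c - a) (d - a) + cross (b - a) (d - a) * cross v (d - a) := by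
    simp [cross]; ring
  have ey : cross (b - a) (d - a) * cross (b - a) (c + v - a) =
      cross (b - a) (d - a) * cross (b - a) (c - a) + cross (b - a) (d - a) * cross (b - a) v := by
    simp [cross]; ring
  rw [ex, ey] at cd
  have X0 := congrFun hX 0
  have X1 := congrFun hX 1
  have Y0 := congrFun hY 0
  have Y1 := congrFun hY 1
  simp only [latticePoint, Pi.add_apply, Pi.smul_apply, Pi.sub_apply, smul_eq_mul]
    at X0 X1 Y0 Y1
  obtain ⟨δ, hδe⟩ : ∃ δ, cross (b - a) (d - a) = δ := ⟨_, rfl⟩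
  have hδr : (δ : ℝ) * δ = 1 := by rw [hδe] at hδ; exact_mod_cast hδ
  have hδer : ((b 0 - a 0) * (d 1 - a 1) - (b 1 - a 1) * (d 0 - a 0) : ℝ) = δ := by
    rw [← hδe]; simp [cross]
  obtain ⟨xc, hxc⟩ : ∃ x, δ * cross (c - a) (d - a) = x := ⟨_, rfl⟩
  obtain ⟨yc, hyc⟩ : ∃ x, δ * cross (b - a) (c - a) = x := ⟨_, rfl⟩
  obtain ⟨xv, hxv⟩ : ∃ x, δ * cross v (d - a) = x := ⟨_, rfl⟩
  obtain ⟨yv, hyv⟩ : ∃ x, δ * cross (b - a) v = x := ⟨_, rfl⟩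
  rw [hδe, hxc, hyc] at cc
  rw [hδe, hxc, hyc, hxv, hyv] at cd
  have hxc' : (δ * ((c 0 - a 0) * (d 1 - a 1) - (c 1 - a 1) * (d 0 - a 0)) : ℝ) = xc := by
    rw [← hxc]; simp [cross]
  have hyc' : (δ * ((b 0 - a 0) * (c 1 - a 1) - (b 1 - a 1) * (c 0 - a 0)) : ℝ) = yc := by
    rw [← hyc]; simp [cross]
  have hxv' : (δ * (v 0 * (d 1 - a 1) - v 1 * (d 0 - a 0)) : ℝ) = xv := by
    rw [← hxv]; simp [cross]
  have hyv' : (δ * ((b 0 - a 0) * v 1 - (b 1 - a 1) * v 0) : ℝ) = yv := by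
    rw [← hyv]; simp [cross]
  have r1 : (xc : ℝ) + θ * xv = t := by
    rw [← hxc', ← hxv']
    linear_combination (-(δ : ℝ) * (d 1 - a 1)) * X0 + (δ * (d 0 - a 0)) * X1 +
      t * δ * hδer + t * hδr
  have r2 : (yc : ℝ) + θ * yv = 0 := by
    rw [← hyc', ← hyv']
    linear_combination (-(δ : ℝ) * (b 0 - a 0)) * X1 + (δ * (b 1 - a 1)) * X0
  have r3 : (xc : ℝ) + φ * xv = 0 := by
    rw [← hxc', ← hxv']
    linear_combination (-(δ : ℝ) * (d 1 - a 1)) * Y0 + (δ * (d 0 - a 0)) * Y1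
  have r4 : (yc : ℝ) + φ * yv = t' := by
    rw [← hyc', ← hyv']
    linear_combination (-(δ : ℝ) * (b 0 - a 0)) * Y1 + (δ * (b 1 - a 1)) * Y0 +
      t' * δ * hδer + t' * hδr
  -- The crossing with `ab` lies between `c` and `c + v` and has coordinate sum `t > 0`, so the sums
  -- at both ends cannot be nonpositive.
  have fin : xc + yc ≤ 0 → xc + xv + (yc + yv) ≤ 0 → False := by
    intro u w
    have u' : (xc : ℝ) + yc ≤ 0 := by exact_mod_cast u
    have w' : (xc : ℝ) + xv + (yc + yv) ≤ 0 := by exact_mod_cast w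
    have m1 := mul_nonpos_of_nonneg_of_nonpos hθ.le w'
    have m2 := mul_nonpos_of_nonneg_of_nonpos (by linarith : (0 : ℝ) ≤ 1 - θ) u'
    linarith
  have s1 : (θ - φ) * xv = t := by linarith
  have s2 : (φ - θ) * yv = t' := by linarith
  -- The order of the two crossings decides which end of the segment is beyond `ab` and which is
  -- beyond `ad`; `corner` applies to both.
  rcases lt_trichotomy θ φ with hlt | heq | hgt
  · have hyv0 : (0 : ℝ) < yv := by
      refine (pos_iff_pos_of_mul_pos (a := φ - θ) ?_).1 (by linarith)
      linarith
    have hxv0 : (xv : ℝ) < 0 := by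
      by_contra hcon
      push Not at hcon
      have := mul_nonpos_of_nonpos_of_nonneg (by linarith : θ - φ ≤ 0) hcon
      linarith
    refine fin (cc (Or.inl ?_)) (cd (Or.inr ?_))
    · have : (yc : ℝ) < 0 := by
        have := mul_pos hθ hyv0
        linarith
      exact_mod_cast this
    · have : (xc : ℝ) + xv < 0 := by
        have := mul_neg_of_pos_of_neg (by linarith : 0 < 1 - φ) hxv0
        linarith
      exact_mod_cast this
  · rw [heq] at s1; linarith
  · have hyv0 : (yv : ℝ) < 0 := by
      by_contra hcon
      push Not at hcon
      have := mul_nonpos_of_nonpos_of_nonneg (by linarith : φ - θ ≤ 0) hcon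
      linarith
    have hxv0 : (0 : ℝ) < xv := by
      refine (pos_iff_pos_of_mul_pos (a := θ - φ) ?_).1 (by linarith)
      linarith
    refine fin (cc (Or.inr ?_)) (cd (Or.inl ?_))
    · have : (xc : ℝ) < 0 := by
        have := mul_pos hφ hxv0
        linarith
      exact_mod_cast this
    · have : (yc : ℝ) + yv < 0 := by
        have := mul_neg_of_pos_of_neg (by linarith : 0 < 1 - θ) hyv0
        linarith
      exact_mod_cast this

/-- A lattice triangle of normalized area at least two contains a lattice point which is not one
of its vertices. -/
theorem exists_lattice_combination {e f : Fin 2 → ℤ} (hD : 2 ≤ (cross e f).natAbs) :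
    ∃ (w : Fin 2 → ℤ) (α β : ℝ), 0 ≤ α ∧ 0 ≤ β ∧ α < 1 ∧ β < 1 ∧ 0 < α + β ∧ α + β ≤ 1 ∧
      ∀ i, (w i : ℝ) = α * e i + β * f i := by
  have he : e ≠ 0 := by
    rintro rfl; simp [cross] at hD
  have hg : 0 < Int.gcd (e 0) (e 1) := by
    rw [Int.gcd_pos_iff]
    by_contra hcon
    push Not at hcon
    exact he (by ext i; fin_cases i <;> simp [hcon])
  obtain ⟨e0, h0⟩ : ((Int.gcd (e 0) (e 1) : ℕ) : ℤ) ∣ e 0 := Int.gcd_dvd_left ..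
  obtain ⟨e1, h1⟩ : ((Int.gcd (e 0) (e 1) : ℕ) : ℤ) ∣ e 1 := Int.gcd_dvd_right ..
  -- If `e` is not primitive, its primitive part already lies inside a side.
  rcases Nat.lt_or_ge 1 (Int.gcd (e 0) (e 1)) with hg1 | hg1
  · have hgr : (1 : ℝ) < (Int.gcd (e 0) (e 1) : ℕ) := by exact_mod_cast hg1
    refine ⟨![e0, e1], 1 / (Int.gcd (e 0) (e 1) : ℕ), 0, by positivity, le_rfl, ?_, by norm_num,
      by positivity, ?_, ?_⟩
    · rw [div_lt_one (by linarith)]; exact hgr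
    · rw [add_zero, div_le_one (by linarith)]; exact hgr.le
    · have h0r : (e 0 : ℝ) = (Int.gcd (e 0) (e 1) : ℕ) * e0 := by exact_mod_cast h0
      have h1r : (e 1 : ℝ) = (Int.gcd (e 0) (e 1) : ℕ) * e1 := by exact_mod_cast h1
      generalize ((Int.gcd (e 0) (e 1) : ℕ) : ℝ) = g at *
      intro i
      fin_cases i <;> simp
      · rw [h0r]; field_simp
      · rw [h1r]; field_simp
  · have hg1 : Int.gcd (e 0) (e 1) = 1 := by omega
    have bez := Int.gcd_eq_gcd_ab (e 0) (e 1)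
    rw [hg1] at bez
    set p := Int.gcdA (e 0) (e 1)
    set q := Int.gcdB (e 0) (e 1)
    set σ := (cross e f).sign with hσ
    have hσ1 : σ * σ = 1 := by
      have : cross e f ≠ 0 := by intro h; simp [h] at hD
      rcases lt_or_gt_of_ne this with h | h
      · simp [hσ, Int.sign_eq_neg_one_of_neg h]
      · simp [hσ, Int.sign_eq_one_of_pos h]
    have hσD : σ * cross e f = (cross e f).natAbs := by
      rw [Int.natCast_natAbs, hσ, Int.sign_mul_self_eq_abs]
    set D : ℕ := (cross e f).natAbs
    set k : ℤ := p * f 0 + q * f 1 with hk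
    -- the vector `h = σ (-q, p)` completes `e` to a basis with `f = k e + D h`
    have f0 : f 0 = k * e 0 + D * (σ * -q) := by
      rw [← hσD, hk]
      simp only [cross]
      push_cast at bez
      linear_combination (f 0) * bez + (-q) * (e 0 * f 1 - e 1 * f 0) * (-hσ1)
    have f1 : f 1 = k * e 1 + D * (σ * p) := by
      rw [← hσD, hk]
      simp only [cross]
      push_cast at bez
      linear_combination (f 1) * bez + p * (e 0 * f 1 - e 1 * f 0) * (-hσ1)
    have hDr : (2 : ℝ) ≤ D := by exact_mod_cast hD
    -- `j` is the ceiling of `k / D`: then `j e + h = (j - k / D) e + f / D`, and `0 ≤ j - k / D ≤ 1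
    -- - 1 / D` keeps it in the triangle.
    set j : ℤ := -((-k) / (D : ℤ)) with hj
    have hDz : (0 : ℤ) < D := by omega
    have j1 : k ≤ j * D := by
      have := Int.ediv_mul_le (-k) hDz.ne'
      rw [hj]; linarith
    have j2 : j * D ≤ k + D - 1 := by
      have := Int.lt_ediv_add_one_mul_self (-k) hDz
      rw [hj]; linarith
    have j1r : (k : ℝ) ≤ j * D := by exact_mod_cast j1
    have j2r : (j : ℝ) * D ≤ k + D - 1 := by exact_mod_cast j2
    have f0r : (f 0 : ℝ) = k * e 0 + D * (σ * -q) := by exact_mod_cast f0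
    have f1r : (f 1 : ℝ) = k * e 1 + D * (σ * p) := by exact_mod_cast f1
    have hDp : (0 : ℝ) < D := by linarith
    have hα : (j - k / D : ℝ) = (j * D - k) / D := by field_simp
    refine ⟨![j * e 0 + σ * -q, j * e 1 + σ * p], j - k / D, 1 / D, ?_, by positivity, ?_, ?_, ?_,
      ?_, ?_⟩
    · rw [hα]; exact div_nonneg (by linarith) hDp.le
    · rw [hα, div_lt_one hDp]; linarith
    · rw [div_lt_one hDp]; linarith
    · rw [hα, ← add_div]; exact div_pos (by linarith) hDp
    · rw [hα, ← add_div, div_le_one hDp]; linarith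
    · intro i
      fin_cases i <;> simp
      · rw [f0r]; field_simp; ring
      · rw [f1r]; field_simp; ring

theorem natAbs_lt_of_eq_mul {x y : ℤ} {κ : ℝ} (h0 : 0 ≤ κ) (h1 : κ < 1) (hy : y.natAbs ≠ 0)
    (h : (x : ℝ) = κ * y) : x.natAbs < y.natAbs := by
  have hy' : (0 : ℝ) < |(y : ℝ)| := by
    rw [abs_pos]
    have : y ≠ 0 := by omega
    exact_mod_cast this
  have h2 : |(x : ℝ)| < |(y : ℝ)| := by
    rw [h, abs_mul, abs_of_nonneg h0]
    nlinarith
  have h3 : |x| < |y| := by exact_mod_cast h2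
  rw [Int.abs_eq_natAbs, Int.abs_eq_natAbs] at h3
  exact_mod_cast h3

theorem Cut.segment_inter_nonempty {c v a b : Fin 2 → ℤ} (h : Cut R Q c v) (hR : Convex ℝ R)
    (hQ : Convex ℝ Q) (ha : latticePoint a ∈ R) (hb : latticePoint b ∈ R)
    (hca : 0 < cross (latticePoint v) (latticePoint a - latticePoint c))
    (hcb : cross (latticePoint v) (latticePoint b - latticePoint c) ≤ 0) :
    (segment ℝ (latticePoint a) (latticePoint b) ∩ Q).Nonempty := by
  obtain ⟨t, θ, ht, ht1, hθ, hθ1, -, hX⟩ := h.exists_mem hR ha hb hca hcb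
  refine ⟨_, ?_, h.mem_of_chord hQ hθ hθ1⟩
  rw [← hX, segment_eq_image']
  exact ⟨t, ⟨ht.le, ht1⟩, rfl⟩

/-- Take a cut with `w` beyond it. Since `[a, b]` meets `Q`, one of `a`, `b` is on the side of `Q`,
and the segment from `w` to it crosses the chord. -/
theorem segment_inter_or (hR : Convex ℝ R) (hQ : Convex ℝ Q)
    (hcut : ∀ a, latticePoint a ∈ R → ∃ c v, Cut R Q c v ∧
      0 < cross (latticePoint v) (latticePoint a - latticePoint c))
    {w a b : Fin 2 → ℤ} (hw : latticePoint w ∈ R) (ha : latticePoint a ∈ R)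
    (hb : latticePoint b ∈ R)
    (hab : (segment ℝ (latticePoint a) (latticePoint b) ∩ Q).Nonempty) :
    (segment ℝ (latticePoint w) (latticePoint a) ∩ Q).Nonempty ∨
      (segment ℝ (latticePoint w) (latticePoint b) ∩ Q).Nonempty := by
  obtain ⟨c, v, h, hwc⟩ := hcut w hw
  rcases le_or_gt (cross (latticePoint v) (latticePoint a - latticePoint c)) 0 with h1 | h1
  · exact Or.inl (h.segment_inter_nonempty hR hQ hw ha hwc h1)
  · obtain ⟨x, hx, hxQ⟩ := hab
    exact Or.inr (h.segment_inter_nonempty hR hQ hw hb hwc (h.le_of_mem hx hxQ h1))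

/-- No lattice triangle in `R` has all its sides meeting `Q`. -/
theorem false_of_triangle (hR : Convex ℝ R) (hQ : Convex ℝ Q)
    (hdisj : ∀ z, latticePoint z ∈ R → latticePoint z ∉ Q)
    (hcut : ∀ a, latticePoint a ∈ R → ∃ c v, Cut R Q c v ∧
      0 < cross (latticePoint v) (latticePoint a - latticePoint c))
    (N : ℕ) : ∀ a b d : Fin 2 → ℤ, (cross (b - a) (d - a)).natAbs = N →
      latticePoint a ∈ R → latticePoint b ∈ R → latticePoint d ∈ R →
      (segment ℝ (latticePoint a) (latticePoint b) ∩ Q).Nonempty →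
      (segment ℝ (latticePoint b) (latticePoint d) ∩ Q).Nonempty →
      (segment ℝ (latticePoint d) (latticePoint a) ∩ Q).Nonempty → False := by
  induction N using Nat.strong_induction_on with
  | _ N ih =>
  intro a b d hN ha hb hd hab hbd hda
  have cutof : ∀ {a b d : Fin 2 → ℤ}, latticePoint a ∈ R →
      (segment ℝ (latticePoint a) (latticePoint b) ∩ Q).Nonempty →
      (segment ℝ (latticePoint d) (latticePoint a) ∩ Q).Nonempty →
      ∃ c v, Cut R Q c v ∧ 0 < cross (latticePoint v) (latticePoint a - latticePoint c) ∧
        cross (latticePoint v) (latticePoint b - latticePoint c) ≤ 0 ∧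
        cross (latticePoint v) (latticePoint d - latticePoint c) ≤ 0 := by
    intro a b d ha hab hda
    obtain ⟨c, v, h, hc⟩ := hcut a ha
    obtain ⟨x, hx, hxQ⟩ := hab
    obtain ⟨y, hy, hyQ⟩ := hda
    rw [segment_symm] at hy
    exact ⟨c, v, h, hc, h.le_of_mem hx hxQ hc, h.le_of_mem hy hyQ hc⟩
  rcases Nat.lt_or_ge N 2 with hN2 | hN2
  · interval_cases N
    -- Degenerate triangles must be covered, since the extra lattice point may lie on a side. Of
    -- three collinear points, the middle one cannot be separated from both others by a line.
    · obtain ⟨c₁, v₁, -, p₁, q₁, r₁⟩ := cutof ha hab hda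
      obtain ⟨c₂, v₂, -, p₂, q₂, r₂⟩ := cutof hb hbd hab
      obtain ⟨c₃, v₃, -, p₃, q₃, r₃⟩ := cutof hd hda hbd
      have h0 : cross (b - a) (d - a) = 0 := Int.natAbs_eq_zero.1 hN
      have h0' : cross (latticePoint b - latticePoint a) (latticePoint d - latticePoint a) = 0 := by
        rw [← latticePoint_sub, ← latticePoint_sub, cross_latticePoint, h0]; simp
      have split : ∀ v x c : Fin 2 → ℤ, cross (latticePoint v) (latticePoint x - latticePoint c) =
          cross (latticePoint v) (latticePoint x - latticePoint a) +
          cross (latticePoint v) (latticePoint a - latticePoint c) := by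
        intro v x c; simp [cross]; ring
      have prop : ∀ v : Fin 2 → ℤ,
          cross (latticePoint v) (latticePoint d - latticePoint a) *
            cross (latticePoint v₁) (latticePoint b - latticePoint a) =
          cross (latticePoint v₁) (latticePoint d - latticePoint a) *
            cross (latticePoint v) (latticePoint b - latticePoint a) := by
        intro v
        simp only [cross, Pi.sub_apply] at h0' ⊢
        linear_combination (latticePoint v 0 * latticePoint v₁ 1 -
          latticePoint v 1 * latticePoint v₁ 0) * (-h0')
      have e2 := prop v₂
      have e3 := prop v₃
      rw [split v₁] at q₁ r₁
      rw [split v₂] at p₂ q₂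
      rw [split v₃] at p₃ r₃
      generalize cross (latticePoint v₁) (latticePoint b - latticePoint a) = A at *
      generalize cross (latticePoint v₁) (latticePoint d - latticePoint a) = B at *
      generalize cross (latticePoint v₂) (latticePoint b - latticePoint a) = A₂ at *
      generalize cross (latticePoint v₂) (latticePoint d - latticePoint a) = B₂ at *
      generalize cross (latticePoint v₃) (latticePoint b - latticePoint a) = A₃ at *
      generalize cross (latticePoint v₃) (latticePoint d - latticePoint a) = B₃ at *
      have hA : A < 0 := by linarith
      have hB : B < 0 := by linarith
      have h1 : A < B := by
        have k1 : 0 < A₂ := by linarith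
        have k2 : B₂ < A₂ := by linarith
        have := mul_lt_mul_of_neg_right k2 hA
        rw [e2, mul_comm A₂] at this
        exact lt_of_mul_lt_mul_right this k1.le
      have h2 : B < A := by
        have k1 : 0 < B₃ := by linarith
        have k2 : A₃ < B₃ := by linarith
        have := mul_lt_mul_of_neg_left k2 hB
        rw [← e3, mul_comm] at this
        exact lt_of_mul_lt_mul_left this k1.le
      linarith
    · obtain ⟨c, v, h, p, q, r⟩ := cutof ha hab hda
      refine h.false_of_unimodular hR hQ ?_ ha hb hd (hdisj b hb) (hdisj d hd) hbd p q r
      rw [← Int.natAbs_mul_self, hN]; simp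
  · subst hN
    obtain ⟨w, α, β, hα, hβ, hα1, hβ1, hp, hle, hw⟩ := exists_lattice_combination hN2
    have hwR : latticePoint (a + w) ∈ R := by
      refine hR.mem_of_weights ha hb hd (p := 1 - α - β) (q := α) (r := β) (by linarith) hα hβ
        (by linarith) ?_ ?_ <;>
      · simp only [latticePoint_apply, Pi.add_apply, Int.cast_add, hw, Pi.sub_apply, Int.cast_sub]
        ring
    have hw0 := hw 0
    have hw1 := hw 1
    simp only [Pi.sub_apply, Int.cast_sub] at hw0 hw1
    have hne : (cross (b - a) (d - a)).natAbs ≠ 0 := by omega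
    have A1 : (cross (b - (a + w)) (d - (a + w))).natAbs < (cross (b - a) (d - a)).natAbs := by
      refine natAbs_lt_of_eq_mul (κ := 1 - α - β) (by linarith) (by linarith) hne ?_
      simp [cross, hw0, hw1]; ring
    have A2 : (cross (a + w - a) (d - a)).natAbs < (cross (b - a) (d - a)).natAbs := by
      refine natAbs_lt_of_eq_mul hα hα1 hne ?_
      simp [cross, hw0, hw1]; ring
    have A3 : (cross (b - a) (a + w - a)).natAbs < (cross (b - a) (d - a)).natAbs := by
      refine natAbs_lt_of_eq_mul hβ hβ1 hne ?_
      simp [cross, hw0, hw1]; ring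
    -- One alternative per side: `a + w` is joined through `Q` to at least two vertices, and with
    -- them forms a smaller triangle.
    have o1 := segment_inter_or hR hQ hcut hwR ha hb hab
    have o2 := segment_inter_or hR hQ hcut hwR hb hd hbd
    have o3 := segment_inter_or hR hQ hcut hwR hd ha hda
    have S : ∀ x, (segment ℝ (latticePoint x) (latticePoint (a + w)) ∩ Q).Nonempty ↔
      (segment ℝ (latticePoint (a + w)) (latticePoint x) ∩ Q).Nonempty := by
      intro x; rw [segment_symm]
    have T1 := ih _ A1 (a + w) b d rfl hwR hb hd
    have T2 := ih _ A2 a (a + w) d rfl ha hwR hd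
    have T3 := ih _ A3 a b (a + w) rfl ha hb hwR
    rw [S] at T1 T2 T3
    tauto

/-! ### The contradiction from cuts -/

/-- If every lattice point of `R` is beyond a cut, then `R` has no lattice point. -/
theorem false_of_cuts (hR : Convex ℝ R) (hQ : Convex ℝ Q)
    (hdisj : ∀ z, latticePoint z ∈ R → latticePoint z ∉ Q)
    (hcut : ∀ a, latticePoint a ∈ R → ∃ c v, Cut R Q c v ∧
      0 < cross (latticePoint v) (latticePoint a - latticePoint c))
    {a : Fin 2 → ℤ} (ha : latticePoint a ∈ R) : False := by
  have shift : ∀ s v c : Fin 2 → ℤ, cross (latticePoint v) (latticePoint (s + v) - latticePoint c) =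
      cross (latticePoint v) (latticePoint s - latticePoint c) := by
    intro s v c
    simp [cross, latticePoint_add]; ring
  obtain ⟨c₁, v₁, h₁, p₁⟩ := hcut a ha
  obtain ⟨s₁, hs₁, hs₁', n₁⟩ := h₁.translate
  obtain ⟨c₂, v₂, h₂, p₂⟩ := hcut s₁ hs₁
  obtain ⟨s₂, hs₂, hs₂', n₂⟩ := h₂.translate
  -- Otherwise all sides of the triangle `a`, `s₁`, `x` meet `Q`.
  have tri : ∀ x, latticePoint x ∈ R →
      0 < cross (latticePoint v₁) (latticePoint x - latticePoint c₁) ∨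
      0 < cross (latticePoint v₂) (latticePoint x - latticePoint c₂) := by
    intro x hx
    by_contra hcon
    push Not at hcon
    refine false_of_triangle hR hQ hdisj hcut _ a s₁ x rfl ha hs₁ hx
      (h₁.segment_inter_nonempty hR hQ ha hs₁ p₁ n₁.le)
      (h₂.segment_inter_nonempty hR hQ hs₁ hx p₂ hcon.2) ?_
    rw [segment_symm]
    exact h₁.segment_inter_nonempty hR hQ ha hx p₁ hcon.1
  refine h₁.false_of_two h₂ hR hs₁ hs₁' hs₂ hs₂' n₁ n₂ ((tri _ hs₂).resolve_right n₂.not_gt)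
    ((tri _ hs₂').resolve_right ?_) p₂ ((tri _ hs₁').resolve_left ?_)
  · rw [shift]; exact n₂.not_gt
  · rw [shift]; exact n₁.not_gt

end Cuts

/-! ### Cuts from the edges of `Q` -/

/-- In coordinates `(ξ, η)`, a finite set whose points on the axis `ξ = 0`, and whose segments
across it, all stay below the origin lies strictly below a line through the origin. Its slope
separates the ratios `η / ξ` on the two sides. -/
theorem exists_slope {α : Type*} {V : Set α} (hV : V.Finite) {ξ η : α → ℝ}
    (h0 : ∀ y ∈ V, ξ y = 0 → η y < 0)
    (h1 : ∀ p ∈ V, ∀ q ∈ V, ξ p < 0 → 0 < ξ q → ξ q * η p - ξ p * η q < 0) :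
    ∃ σ : ℝ, ∀ y ∈ V, η y - σ * ξ y < 0 := by
  classical
  obtain ⟨σ, hs, ht⟩ := Finset.exists_between'
    ((hV.toFinset.filter fun y => 0 < ξ y).image fun y => η y / ξ y)
    ((hV.toFinset.filter fun y => ξ y < 0).image fun y => η y / ξ y) (by
      simp only [Finset.mem_image, Finset.mem_filter, Set.Finite.mem_toFinset]
      rintro _ ⟨q, ⟨hq, hq0⟩, rfl⟩ _ ⟨p, ⟨hp, hp0⟩, rfl⟩
      have := h1 p hp q hq hp0 hq0
      rw [← neg_div_neg_eq (η p), div_lt_div_iff₀ hq0 (by linarith)]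
      linarith)
  simp only [Finset.mem_image, Finset.mem_filter, Set.Finite.mem_toFinset, forall_exists_index,
    and_imp] at hs ht
  refine ⟨σ, fun y hy => ?_⟩
  rcases lt_trichotomy (ξ y) 0 with h | h | h
  · have := ht _ y hy h rfl
    rw [lt_div_iff_of_neg h] at this
    linarith
  · rw [h]; linarith [h0 y hy h]
  · have := hs _ y hy h rfl
    rw [div_lt_iff₀ h] at this
    linarith

/-- A segment joining a point `o` of a lattice polygon `Q` to a point `a` outside of it leaves `Q`
through the relative interior of an edge, unless it passes through a lattice point of `Q`. -/
theorem exists_edge {V R Q : Set (Fin 2 → ℝ)} (hV : V.Finite) (hVl : V ⊆ integerLattice)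
    (hQV : Q = convexHull ℝ V) (hR : Convex ℝ R)
    (hdisj : ∀ z, latticePoint z ∈ R → latticePoint z ∉ Q) {o a : Fin 2 → ℝ} (hoR : o ∈ R)
    (hoQ : o ∈ Q) (haR : a ∈ R) (haQ : a ∉ Q) :
    ∃ (p q : Fin 2 → ℤ) (θ : ℝ), latticePoint p ∈ Q ∧ latticePoint q ∈ Q ∧
      (∀ y ∈ Q, cross (latticePoint (p - q)) (y - latticePoint q) ≤ 0) ∧
      0 < cross (latticePoint (p - q)) (a - latticePoint q) ∧ 0 < θ ∧ θ < 1 ∧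
      latticePoint q + θ • latticePoint (p - q) ∈ R := by
  have hQ : Convex ℝ Q := hQV ▸ convex_convexHull ℝ V
  have hVQ : V ⊆ Q := hQV ▸ subset_convexHull ℝ V
  have hQc : IsCompact Q := hQV ▸ hV.isCompact_convexHull (𝕜 := ℝ)
  obtain ⟨w, hw⟩ : ∃ w, w = a - o := ⟨_, rfl⟩
  have hww : 0 < w 0 * w 0 + w 1 * w 1 := by
    have : w ≠ 0 := by
      rintro rfl
      rw [eq_comm, sub_eq_zero] at hw
      exact haQ (hw ▸ hoQ)
    by_contra hcon
    have h0 : w 0 = 0 := by nlinarith [mul_self_nonneg (w 0), mul_self_nonneg (w 1)]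
    have h1 : w 1 = 0 := by nlinarith [mul_self_nonneg (w 0), mul_self_nonneg (w 1)]
    exact this (by ext i; fin_cases i <;> simp [h0, h1])
  -- `x` is the last point of `Q` on the ray from `o` through `a`
  obtain ⟨x, ⟨hxQ, hxl⟩, hxmax⟩ := (hQc.inter_right (t := {y | cross w (y - o) = 0})
    (isClosed_eq (by unfold cross; simp only [Pi.sub_apply]; fun_prop) continuous_const)).exists_isMaxOn
      ⟨o, hoQ, by simp [cross]⟩
      (f := fun y => w 0 * y 0 + w 1 * y 1) (by fun_prop)
  simp only [Set.mem_ofPred_eq] at hxl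
  have hmax : ∀ y ∈ Q, cross w (y - x) = 0 → w 0 * (y 0 - x 0) + w 1 * (y 1 - x 1) ≤ 0 := by
    intro y hy hyl
    have := hxmax (a := y) ⟨hy, by simp [cross] at hyl hxl ⊢; linarith⟩
    simp only [Set.mem_ofPred_eq] at this
    linarith
  have hox := hmax o hoQ (by simp [cross] at hxl ⊢; linarith)
  have hax : 0 < w 0 * (a 0 - x 0) + w 1 * (a 1 - x 1) := by
    by_contra hcon
    push Not at hcon
    refine haQ (hQ.mem_of_two_weights hoQ hxQ
      (p := -(w 0 * (a 0 - x 0) + w 1 * (a 1 - x 1))) (q := w 0 * w 0 + w 1 * w 1)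
      (by linarith) hww.le (by linarith) ?_ ?_)
    · simp [hw, cross] at hxl ⊢
      linear_combination (a 1 - o 1) * hxl
    · simp [hw, cross] at hxl ⊢
      linear_combination (-(a 0 - o 0)) * hxl
  have hxR : x ∈ R := by
    refine hR.mem_of_two_weights hoR haR
      (p := w 0 * (a 0 - x 0) + w 1 * (a 1 - x 1))
      (q := -(w 0 * (o 0 - x 0) + w 1 * (o 1 - x 1))) hax.le (by linarith) (by linarith) ?_ ?_
    · simp [hw, cross] at hxl ⊢
      linear_combination (-(a 1 - o 1)) * hxl
    · simp [hw, cross] at hxl ⊢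
      linear_combination (a 0 - o 0) * hxl
  have hxa : cross w (a - x) = 0 := by
    simp [hw, cross] at hxl ⊢
    linarith
  clear hxmax hxl hox
  -- Coordinates centred at `x`: `η` measures along the ray, `ξ` across it.
  set ξ : (Fin 2 → ℝ) → ℝ := fun y => cross w (y - x) with hξ
  set η : (Fin 2 → ℝ) → ℝ := fun y => w 0 * (y 0 - x 0) + w 1 * (y 1 - x 1) with hη
  have hcross : ∀ y y' : Fin 2 → ℝ, ∀ z, (w 0 * w 0 + w 1 * w 1) * cross (y - y') (z - y') =
      (η y - η y') * (ξ z - ξ y') - (ξ y - ξ y') * (η z - η y') := by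
    intro y y' z
    simp [hξ, hη, cross]; ring
  have hpair : ∀ p ∈ Q, ∀ q ∈ Q, ξ p < 0 → 0 < ξ q → ξ q * η p - ξ p * η q ≤ 0 := by
    intro p hp q hq hp0 hq0
    have hd : 0 < ξ q - ξ p := by linarith
    obtain ⟨y, hy0, hy1⟩ : ∃ y : Fin 2 → ℝ, (ξ q - ξ p) * y 0 = ξ q * p 0 + -ξ p * q 0 ∧
        (ξ q - ξ p) * y 1 = ξ q * p 1 + -ξ p * q 1 := by
      refine ⟨fun i => (ξ q * p i + -ξ p * q i) / (ξ q - ξ p), ?_, ?_⟩ <;> field_simp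
    have hyQ : y ∈ Q := hQ.mem_of_two_weights hp hq (p := ξ q) (q := -ξ p) hq0.le (by linarith)
      (by linarith) (by linarith) (by linarith)
    have hy2 : ξ y = 0 := by
      have : (ξ q - ξ p) * ξ y = 0 := by
        have e : (ξ q - ξ p) * ξ y = ξ q * ξ p - ξ p * ξ q := by
          have : ξ y = w 0 * (y 1 - x 1) - w 1 * (y 0 - x 0) := by simp [hξ, cross]
          rw [this]
          have hp' : ξ p = w 0 * (p 1 - x 1) - w 1 * (p 0 - x 0) := by simp [hξ, cross]
          have hq' : ξ q = w 0 * (q 1 - x 1) - w 1 * (q 0 - x 0) := by simp [hξ, cross]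
          generalize ξ p = P at *
          generalize ξ q = Q' at *
          linear_combination w 0 * hy1 - w 1 * hy0 - Q' * hp' + P * hq'
        rw [e]; ring
      exact (mul_eq_zero.1 this).resolve_left hd.ne'
    have := hmax y hyQ hy2
    have e : (ξ q - ξ p) * (w 0 * (y 0 - x 0) + w 1 * (y 1 - x 1)) =
        ξ q * η p - ξ p * η q := by
      simp only [hη]
      linear_combination w 0 * hy0 + w 1 * hy1
    rw [← e]
    exact mul_nonpos_of_nonneg_of_nonpos hd.le this
  -- Equality would make `x` a lattice point of `R ∩ Q`.
  have hzero : ∀ y ∈ V, ξ y = 0 → η y < 0 := by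
    intro y hy hy0
    refine lt_of_le_of_ne (hmax y (hVQ hy) hy0) fun hy1 => ?_
    have : y = x := by
      simp only [hη] at hy1
      simp only [hξ, cross, Pi.sub_apply] at hy0
      have e0 : (w 0 * w 0 + w 1 * w 1) * (y 0 - x 0) = 0 := by
        linear_combination w 0 * hy1 - w 1 * hy0
      have e1 : (w 0 * w 0 + w 1 * w 1) * (y 1 - x 1) = 0 := by
        linear_combination w 1 * hy1 + w 0 * hy0
      have e0 := (mul_eq_zero.1 e0).resolve_left hww.ne'
      have e1 := (mul_eq_zero.1 e1).resolve_left hww.ne'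
      ext i; fin_cases i
      · simp; linarith
      · simp; linarith
    obtain ⟨z, rfl⟩ := hVl hy
    change latticePoint z = x at this
    exact hdisj z (this ▸ hxR) (hVQ hy)
  -- The last equation says that `[p, q]` passes through `x`. Without such a pair, a line through
  -- `x` would have all of `V` strictly on one side, against `x ∈ Q`.
  obtain ⟨p, hp, q, hq, hp0, hq0, hpq⟩ : ∃ p ∈ V, ∃ q ∈ V, ξ p < 0 ∧ 0 < ξ q ∧
      ξ q * η p - ξ p * η q = 0 := by
    by_contra hcon
    push Not at hcon
    obtain ⟨σ, hσ⟩ := exists_slope hV hzero fun p hp q hq hp0 hq0 =>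
      lt_of_le_of_ne (hpair p (hVQ hp) q (hVQ hq) hp0 hq0) (hcon p hp q hq hp0 hq0)
    have hconv : Convex ℝ {y | η y - σ * ξ y < 0} := by
      intro y hy z hz s t hs ht hst
      simp only [Set.mem_ofPred_eq] at hy hz ⊢
      have : η (s • y + t • z) - σ * ξ (s • y + t • z) =
          s * (η y - σ * ξ y) + t * (η z - σ * ξ z) := by
        obtain rfl : s = 1 - t := by linarith
        simp [hη, hξ, cross]; ring
      rw [this]
      rcases hs.eq_or_lt with rfl | hs'
      · obtain rfl : t = 1 := by linarith
        linarith
      · have := mul_neg_of_pos_of_neg hs' hy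
        have := mul_nonpos_of_nonneg_of_nonpos ht hz.le
        linarith
    have : x ∈ {y | η y - σ * ξ y < 0} := convexHull_min (fun y hy => hσ y hy) hconv (hQV ▸ hxQ)
    simp [hη, hξ, cross] at this
  -- Two forms of the same determinant: this one controls points with `ξ ≤ 0` by comparison with
  -- `q`, the next one those with `ξ > 0` by comparison with `p`.
  have hN : ∀ z, (w 0 * w 0 + w 1 * w 1) * ξ q * cross (p - q) (z - q) =
      (ξ q - ξ p) * (ξ q * η z - ξ z * η q) := by
    intro z
    linear_combination ξ q * hcross p q z + (ξ z - ξ q) * hpq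
  have hN' : ∀ z, (w 0 * w 0 + w 1 * w 1) * -ξ p * cross (p - q) (z - q) =
      (ξ q - ξ p) * (ξ z * η p - ξ p * η z) := by
    intro z
    linear_combination -ξ p * hcross p q z + (ξ p - ξ z) * hpq
  have hd : 0 < ξ q - ξ p := by linarith
  have hcq : 0 < (w 0 * w 0 + w 1 * w 1) * ξ q := mul_pos hww hq0
  have hcp : 0 < (w 0 * w 0 + w 1 * w 1) * -ξ p := mul_pos hww (by linarith)
  have hsupp : ∀ y ∈ Q, cross (p - q) (y - q) ≤ 0 := by
    intro y hy
    rcases lt_trichotomy (ξ y) 0 with h | h | h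
    · refine nonpos_of_mul_nonpos_right (a := _) ?_ hcq
      rw [hN]
      exact mul_nonpos_of_nonneg_of_nonpos hd.le (hpair y hy q (hVQ hq) h hq0)
    · refine nonpos_of_mul_nonpos_right (a := _) ?_ hcq
      rw [hN, h]
      refine mul_nonpos_of_nonneg_of_nonpos hd.le ?_
      have := mul_nonpos_of_nonneg_of_nonpos hq0.le (hmax y hy h)
      simp only [hη] at this ⊢
      linarith
    · refine nonpos_of_mul_nonpos_right (a := _) ?_ hcp
      rw [hN']
      exact mul_nonpos_of_nonneg_of_nonpos hd.le (hpair p (hVQ hp) y hy hp0 h)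
  have hapos : 0 < cross (p - q) (a - q) := by
    refine (pos_iff_pos_of_mul_pos (a := (w 0 * w 0 + w 1 * w 1) * ξ q) ?_).1 hcq
    rw [hN]
    have : ξ a = 0 := hxa
    rw [this]
    exact mul_pos hd (by have := mul_pos hq0 hax; simpa [hη] using this)
  have hxe : x = q + (ξ q / (ξ q - ξ p)) • (p - q) := by
    have d0 : ∀ y, (w 0 * w 0 + w 1 * w 1) * (y 0 - x 0) = w 0 * η y - w 1 * ξ y := by
      intro y; simp [hη, hξ, cross]; ring
    have d1 : ∀ y, (w 0 * w 0 + w 1 * w 1) * (y 1 - x 1) = w 1 * η y + w 0 * ξ y := by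
      intro y; simp [hη, hξ, cross]; ring
    have e0 : (w 0 * w 0 + w 1 * w 1) *
        ((ξ q - ξ p) * (x 0 - q 0) - ξ q * (p 0 - q 0)) = 0 := by
      linear_combination ξ p * d0 q - ξ q * d0 p - w 0 * hpq
    have e1 : (w 0 * w 0 + w 1 * w 1) *
        ((ξ q - ξ p) * (x 1 - q 1) - ξ q * (p 1 - q 1)) = 0 := by
      linear_combination ξ p * d1 q - ξ q * d1 p - w 1 * hpq
    have e0 := (mul_eq_zero.1 e0).resolve_left hww.ne'
    have e1 := (mul_eq_zero.1 e1).resolve_left hww.ne'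
    generalize ξ q = A at *
    generalize ξ p = B at *
    ext i
    fin_cases i
    · simp
      field_simp
      linarith
    · simp
      field_simp
      linarith

  obtain ⟨p, rfl⟩ := hVl hp
  obtain ⟨q, rfl⟩ := hVl hq
  refine ⟨p, q, _, hVQ hp, hVQ hq, ?_, ?_, div_pos hq0 hd, ?_, ?_⟩
  · rw [latticePoint_sub]; exact hsupp
  · rw [latticePoint_sub]; exact hapos
  · rw [div_lt_one hd]; linarith
  · rw [latticePoint_sub]; exact hxe ▸ hxR

/-- The edge found by `exists_edge` is divided into primitive steps `v`, and the step containing the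
exit point is the cut. Both its ends are lattice points of `Q`, hence outside `R`, which confines
`R` on that line. -/
theorem exists_cut {V R Q : Set (Fin 2 → ℝ)} (hV : V.Finite) (hVl : V ⊆ integerLattice)
    (hQV : Q = convexHull ℝ V) (hR : Convex ℝ R)
    (hdisj : ∀ z, latticePoint z ∈ R → latticePoint z ∉ Q) {o : Fin 2 → ℝ} (hoR : o ∈ R)
    (hoQ : o ∈ Q)
    (hface : ∀ u : Fin 2 → ℝ, ∀ q₁ ∈ Q, ∀ q₂ ∈ Q, q₁ ≠ q₂ → (∀ y ∈ Q, u ⬝ᵥ y ≤ u ⬝ᵥ q₁) →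
      (∀ y ∈ Q, u ⬝ᵥ y ≤ u ⬝ᵥ q₂) → ∃ s₁ s₂ : Fin 2 → ℤ, s₁ ≠ s₂ ∧ latticePoint s₁ ∈ R ∧
        latticePoint s₂ ∈ R ∧ (∀ y ∈ R, u ⬝ᵥ latticePoint s₁ ≤ u ⬝ᵥ y) ∧
        ∀ y ∈ R, u ⬝ᵥ latticePoint s₂ ≤ u ⬝ᵥ y)
    {a : Fin 2 → ℤ} (ha : latticePoint a ∈ R) :
    ∃ c v, Cut R Q c v ∧ 0 < cross (latticePoint v) (latticePoint a - latticePoint c) := by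
  have hQ : Convex ℝ Q := hQV ▸ convex_convexHull ℝ V
  obtain ⟨p, q, θ, hp, hq, hsupp, hapos, hθ, hθ1, hx⟩ :=
    exists_edge hV hVl hQV hR hdisj hoR hoQ ha (hdisj a ha)
  have hg : 0 < Int.gcd ((p - q) 0) ((p - q) 1) := by
    rw [Int.gcd_pos_iff]
    by_contra hcon
    push Not at hcon
    simp [cross, latticePoint_apply, hcon] at hapos
  obtain ⟨v0, v1, hcop, e0, e1⟩ := Int.exists_gcd_one hg
  set g : ℕ := Int.gcd ((p - q) 0) ((p - q) 1)
  obtain ⟨v, rfl, rfl⟩ : ∃ v : Fin 2 → ℤ, v0 = v 0 ∧ v1 = v 1 := ⟨![v0, v1], rfl, rfl⟩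
  have hgr : (0 : ℝ) < g := by exact_mod_cast hg
  have hpq : latticePoint (p - q) = (g : ℝ) • latticePoint v := by
    ext i
    fin_cases i
    · simp [latticePoint_apply, e0, mul_comm]
    · simp [latticePoint_apply, e1, mul_comm]
  have hv : (0 : ℝ) < v 0 * v 0 + v 1 * v 1 := by
    have : (0 : ℤ) < v 0 * v 0 + v 1 * v 1 := by
      by_contra hcon
      have h0 : v 0 = 0 := by nlinarith [mul_self_nonneg (v 0), mul_self_nonneg (v 1)]
      have h1 : v 1 = 0 := by nlinarith [mul_self_nonneg (v 0), mul_self_nonneg (v 1)]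
      rw [h0, h1] at hcop
      simp at hcop
    exact_mod_cast this
  have hcr : ∀ y, cross (latticePoint (p - q)) (y - latticePoint q) =
      g * cross (latticePoint v) (y - latticePoint q) := by
    intro y
    rw [hpq]; simp [cross]; ring
  set k : ℤ := ⌊θ * g⌋ with hk
  set c : Fin 2 → ℤ := q + k • v with hc
  obtain ⟨ρ, hρ⟩ : ∃ ρ, ρ = θ * g - k := ⟨_, rfl⟩
  have hρ0 : 0 ≤ ρ := by have := Int.floor_le (θ * g); rw [hρ]; linarith
  have hρ1 : ρ < 1 := by have := Int.lt_floor_add_one (θ * g); rw [hρ]; linarith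
  have hk0 : (0 : ℤ) ≤ k := Int.floor_nonneg.2 (by positivity)
  have hkg : k + 1 ≤ g := by
    have : (k : ℝ) < g := by
      have := Int.floor_le (θ * g)
      have : θ * g < g := by nlinarith
      linarith
    have : k < g := by exact_mod_cast this
    omega
  have hk0r : (0 : ℝ) ≤ k := by exact_mod_cast hk0
  have hkgr : (k : ℝ) + 1 ≤ g := by exact_mod_cast hkg
  have hcq : latticePoint c = latticePoint q + (k : ℝ) • latticePoint v := by
    ext i; simp [hc, latticePoint_apply]
  have hpe : latticePoint p = latticePoint q + (g : ℝ) • latticePoint v := by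
    rw [← hpq, latticePoint_sub]; simp
  have hcQ : latticePoint c ∈ Q := by
    refine hQ.mem_of_two_weights hp hq (p := k) (q := g - k) hk0r (by linarith) (by linarith) ?_ ?_ <;>
    · simp [hcq, hpe]; ring
  have hcvQ : latticePoint (c + v) ∈ Q := by
    refine hQ.mem_of_two_weights hp hq (p := k + 1) (q := g - k - 1) (by linarith) (by linarith)
      (by linarith) ?_ ?_ <;>
    · simp [latticePoint_add, hcq, hpe]; ring
  have hxc : latticePoint q + θ • latticePoint (p - q) =
      latticePoint c + ρ • latticePoint v := by
    rw [hpq, hcq, hρ]; ext i; simp; ring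
  rw [hxc] at hx
  -- The exit point is not a division point, as that would be a lattice point of `R ∩ Q`.
  have hρ0 : 0 < ρ := by
    refine hρ0.lt_of_ne fun e => hdisj c ?_ hcQ
    simpa [← e] using hx
  have hcr' : ∀ y, cross (latticePoint v) (y - latticePoint c) =
      cross (latticePoint v) (y - latticePoint q) := by
    intro y; rw [hcq]; simp [cross]; ring
  have hchord : ∀ y ∈ R, cross (latticePoint v) (y - latticePoint c) = 0 →
      ∃ θ : ℝ, 0 < θ ∧ θ < 1 ∧ y = latticePoint c + θ • latticePoint v := by
    intro y hy hy0
    obtain ⟨l, hl⟩ : ∃ l : ℝ, y = latticePoint c + l • latticePoint v := by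
      obtain ⟨l, hl⟩ : ∃ l : ℝ, l * (v 0 * v 0 + v 1 * v 1) =
          v 0 * (y 0 - c 0) + v 1 * (y 1 - c 1) := ⟨_, div_mul_cancel₀ _ hv.ne'⟩
      refine ⟨l, ?_⟩
      simp only [cross, latticePoint_apply, Pi.sub_apply] at hy0
      ext i
      refine mul_left_cancel₀ hv.ne' ?_
      simp only [Pi.add_apply, Pi.smul_apply, smul_eq_mul, latticePoint_apply]
      fin_cases i
      · simp only [Fin.zero_eta]
        linear_combination (-(v 1 : ℝ)) * hy0 - v 0 * hl
      · simp only [Fin.mk_one]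
        linear_combination (v 0 : ℝ) * hy0 - v 1 * hl
    refine ⟨l, ?_, ?_, hl⟩
    -- A point of `R` at or before `c` would put `c` in `R` by convexity with the exit point; the
    -- same holds past `c + v`.
    · by_contra hcon
      push Not at hcon
      refine hdisj c (hR.mem_of_two_weights hy hx (p := ρ) (q := -l) hρ0.le (by linarith)
        (by linarith) ?_ ?_) hcQ <;>
      · simp [hl]; ring
    · by_contra hcon
      push Not at hcon
      refine hdisj (c + v) (hR.mem_of_two_weights hy hx (p := 1 - ρ) (q := l - 1) (by linarith)
        (by linarith) (by linarith) ?_ ?_) hcvQ <;>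
      · simp [hl, latticePoint_add]; ring
  have hsupp' : ∀ y ∈ Q, cross (latticePoint v) (y - latticePoint c) ≤ 0 := by
    intro y hy
    rw [hcr']
    have := hsupp y hy
    rw [hcr] at this
    exact nonpos_of_mul_nonpos_right this hgr
  -- The outer normal of the edge is `v` turned by a right angle.
  have hu : ∀ y : Fin 2 → ℝ, ![-(v 1 : ℝ), v 0] ⬝ᵥ y = cross (latticePoint v) y := by
    intro y; simp [dotProduct, cross, Fin.sum_univ_two, latticePoint_apply]; ring
  have hcsub : ∀ x y : Fin 2 → ℝ, cross (latticePoint v) (x - y) =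
      cross (latticePoint v) x - cross (latticePoint v) y := by
    intro x y; simp [cross]; ring
  have hcv : cross (latticePoint v) (latticePoint (c + v)) =
      cross (latticePoint v) (latticePoint c) := by
    rw [latticePoint_add]; simp [cross]; ring
  obtain ⟨s₁, s₂, hne, hs₁, hs₂, m₁, m₂⟩ := hface ![-(v 1 : ℝ), v 0] _ hcQ _ hcvQ (by
      intro e
      have := latticePoint_injective e
      have hv0 : v = 0 := by simpa using this
      simp [hv0] at hv)
    (by intro y hy; rw [hu, hu]; have := hsupp' y hy; rw [hcsub] at this; linarith)
    (by intro y hy; rw [hu, hu, hcv]; have := hsupp' y hy; rw [hcsub] at this; linarith)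
  obtain ⟨h, hh⟩ : ∃ h : ℤ, s₂ = s₁ + h • v := by
    have h12 : cross (latticePoint v) (latticePoint s₂) =
        cross (latticePoint v) (latticePoint s₁) := by
      have a1 := m₁ _ hs₂
      have a2 := m₂ _ hs₁
      rw [hu, hu] at a1 a2
      linarith
    rw [cross_latticePoint, cross_latticePoint] at h12
    have h12 : cross v s₂ = cross v s₁ := by exact_mod_cast h12
    -- `v` is primitive, so the Bézout coefficients recover the integer multiple from `s₂ - s₁`.
    obtain ⟨α, β, hαβ⟩ := Int.isCoprime_iff_gcd_eq_one.2 hcop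
    simp only [cross] at h12
    refine ⟨α * (s₂ 0 - s₁ 0) + β * (s₂ 1 - s₁ 1), ?_⟩
    ext i
    fin_cases i
    · simp
      linear_combination (-(s₂ 0 - s₁ 0)) * hαβ - β * h12
    · simp
      linear_combination (-(s₂ 1 - s₁ 1)) * hαβ + α * h12
  obtain ⟨s, h, hh, hs, hs', ms⟩ : ∃ (s : Fin 2 → ℤ) (h : ℤ), 0 < h ∧ latticePoint s ∈ R ∧
      latticePoint (s + h • v) ∈ R ∧
      ∀ y ∈ R, cross (latticePoint v) (latticePoint s) ≤ cross (latticePoint v) y := by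
    rcases lt_trichotomy h 0 with h0 | h0 | h0
    · refine ⟨s₂, -h, by omega, hs₂, ?_, fun y hy => ?_⟩
      · rw [hh]; simpa using hs₁
      · rw [← hu, ← hu]; exact m₂ y hy
    · exact absurd (by rw [hh, h0]; simp) hne
    · exact ⟨s₁, h, h0, hs₁, hh ▸ hs₂, fun y hy => by rw [← hu, ← hu]; exact m₁ y hy⟩
  have hh1 : (1 : ℝ) ≤ h := by exact_mod_cast hh
  refine ⟨c, v, ⟨hcQ, hcvQ, hsupp', hchord, s, hs, ?_, ?_⟩, ?_⟩
  · refine hR.mem_of_two_weights hs hs' (p := h - 1) (q := 1) (by linarith) zero_le_one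
      (by linarith) ?_ ?_ <;>
    · simp [latticePoint_apply]; ring
  -- `s` is lowest in `R`, so no higher than the exit point. At equal height it would lie on the
  -- chord, hence in `Q`.
  · refine lt_of_le_of_ne ?_ fun e => ?_
    · have e1 := ms _ hx
      have e2 : cross (latticePoint v) (latticePoint c + ρ • latticePoint v) =
          cross (latticePoint v) (latticePoint c) := by simp [cross]; ring
      rw [hcsub]; linarith
    · obtain ⟨t, ht0, ht1, ht⟩ := hchord _ hs e
      refine hdisj s hs (hQ.mem_of_two_weights hcQ hcvQ (p := 1 - t) (q := t) (by linarith) ht0.le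
        (by linarith) ?_ ?_) <;>
      · rw [ht]; simp [latticePoint_add]; ring
  · rw [hcr']
    rw [hcr] at hapos
    exact (pos_iff_pos_of_mul_pos hapos).1 hgr

/-! ### Normal fans and the theorem -/

/-- If the normal fan of `Q` coarsens that of the polygon `P`, then `P` has a nontrivial face in
every direction in which `Q` has one. -/
theorem FanCoarsens.exists_ne_vertices {W P Q : Set (Fin 2 → ℝ)} (hW : W.Finite)
    (hWne : W.Nonempty) (hPW : P = convexHull ℝ W)
    (hPQ : FanCoarsens (normalFan Q) (normalFan P)) {u q₁ q₂ : Fin 2 → ℝ} (hq₁ : q₁ ∈ Q)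
    (hq₂ : q₂ ∈ Q) (hne : q₁ ≠ q₂) (m₁ : ∀ y ∈ Q, u ⬝ᵥ y ≤ u ⬝ᵥ q₁)
    (m₂ : ∀ y ∈ Q, u ⬝ᵥ y ≤ u ⬝ᵥ q₂) :
    ∃ p₁ ∈ W, ∃ p₂ ∈ W, p₁ ≠ p₂ ∧ (∀ y ∈ P, u ⬝ᵥ y ≤ u ⬝ᵥ p₁) ∧ ∀ y ∈ P, u ⬝ᵥ y ≤ u ⬝ᵥ p₂ := by
  have ext : ∀ (u' : Fin 2 → ℝ) (r : ℝ), (∀ y ∈ W, u' ⬝ᵥ y ≤ r) → ∀ y ∈ P, u' ⬝ᵥ y ≤ r := by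
    intro u' r h y hy
    have hconv : Convex ℝ {y | u' ⬝ᵥ y ≤ r} :=
      convex_halfSpace_le ⟨fun x y => dotProduct_add u' x y, fun c x => dotProduct_smul c u' x⟩ r
    exact convexHull_min (fun y hy => h y hy) hconv (hPW ▸ hy)
  have hWP : W ⊆ P := hPW ▸ subset_convexHull ℝ W
  obtain ⟨p, hp, hpmax⟩ := Set.exists_max_image W (fun y => u ⬝ᵥ y) hW hWne
  -- If `p` is the only maximiser of `u` in `W`, all small perturbations of `u` stay in the normal
  -- cone of `P` along `F`, hence in one cone of `Q`. Tilting `u` towards `q - x`, for another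
  -- maximiser `q` in `Q`, leaves the latter.
  by_contra hcon
  push Not at hcon
  have hstrict : ∀ y ∈ W, y ≠ p → u ⬝ᵥ y < u ⬝ᵥ p := by
    intro y hy hyp
    refine lt_of_le_of_ne (hpmax y hy) fun e => ?_
    obtain ⟨x, hx, hlt⟩ := hcon p hp y hy hyp.symm (ext _ _ hpmax)
    have := ext _ _ hpmax x hx
    linarith
  set F : Set (Fin 2 → ℝ) := {x ∈ P | ∀ y ∈ P, u ⬝ᵥ y ≤ u ⬝ᵥ x} with hF
  have hpF : p ∈ F := ⟨hWP hp, ext _ _ hpmax⟩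
  have hFexp : IsExposed ℝ P F := by
    intro _
    refine ⟨∑ i, u i • ContinuousLinearMap.proj i, ?_⟩
    simp [hF, dotProduct]
  obtain ⟨D, ⟨G, ⟨x, hxG⟩, hGexp, rfl⟩, hD⟩ := hPQ.2 _ ⟨F, ⟨p, hpF⟩, hFexp, rfl⟩
  have hxQ : x ∈ Q := hGexp.subset hxG
  have huC : u ∈ normalCone P F := fun x hx y hy => hx.2 y hy
  obtain ⟨q, hq, hqx, mq⟩ : ∃ q ∈ Q, q ≠ x ∧ ∀ y ∈ Q, u ⬝ᵥ y ≤ u ⬝ᵥ q := by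
    by_cases h : q₁ = x
    · exact ⟨q₂, hq₂, fun h' => hne (h.trans h'.symm), m₂⟩
    · exact ⟨q₁, hq₁, h, m₁⟩
  have hux : u ⬝ᵥ q = u ⬝ᵥ x := le_antisymm (hD huC x hxG q hq) (mq x hxQ)
  have hev : ∀ w : Fin 2 → ℝ, ∀ᶠ ε in nhdsWithin (0 : ℝ) (Set.Ioi 0), ∀ y ∈ W,
      (u + ε • w) ⬝ᵥ y ≤ (u + ε • w) ⬝ᵥ p := by
    intro w
    rw [Filter.eventually_all_finite hW]
    intro y hy
    by_cases hyp : y = p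
    · simp [hyp]
    have hc : ∀ y : Fin 2 → ℝ, Continuous fun ε : ℝ => (u + ε • w) ⬝ᵥ y := by
      intro y
      simp only [dotProduct, Pi.add_apply, Pi.smul_apply, smul_eq_mul]
      fun_prop
    have : ∀ᶠ ε in nhds (0 : ℝ), (u + ε • w) ⬝ᵥ y < (u + ε • w) ⬝ᵥ p :=
      (hc y).continuousAt.eventually_lt (hc p).continuousAt (by simpa using hstrict y hy hyp)
    exact (this.filter_mono nhdsWithin_le_nhds).mono fun _ h => h.le
  -- The opposite tilt is needed too: it shows that no point of `F` falls below `p` in the direction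
  -- `q - x`.
  obtain ⟨ε, ⟨h₁, h₂⟩, hε⟩ := (((hev (q - x)).and (hev (-(q - x)))).and
    self_mem_nhdsWithin).exists
  have hε : 0 < ε := hε
  have hmem : u + ε • (q - x) ∈ normalCone P F := by
    intro f hf y hy
    have a1 := ext _ _ h₁ y hy
    have a2 := ext _ _ h₂ f hf.1
    have a3 := hf.2 p (hWP hp)
    simp only [add_dotProduct, smul_dotProduct, neg_dotProduct, smul_eq_mul, mul_neg] at a1 a2 ⊢
    linarith
  have := hD hmem x hxG q hq
  simp only [add_dotProduct, hux, smul_dotProduct, smul_eq_mul] at this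
  have h3 : ε * ((q - x) ⬝ᵥ (q - x)) ≤ 0 := by
    rw [dotProduct_sub]; linarith
  have h4 : (q - x) ⬝ᵥ (q - x) ≤ 0 := nonpos_of_mul_nonpos_right h3 hε
  have h5 : (q - x) ⬝ᵥ (q - x) = 0 := by
    refine le_antisymm h4 ?_
    simp only [dotProduct]
    exact Finset.sum_nonneg fun i _ => mul_self_nonneg _
  exact hqx (sub_eq_zero.1 (dotProduct_self_eq_zero.1 h5))

theorem theorem1 (P Q : Set (Fin 2 → ℝ)) (hP : IsLatticePolygon P) (hQ : IsLatticePolygon Q)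
    (hPQ : FanCoarsens (normalFan Q) (normalFan P)) :
    (P ∩ integerLattice) + (Q ∩ integerLattice) = (P + Q) ∩ integerLattice := by
  ext z
  constructor
  · rintro ⟨_, ⟨hx, x, rfl⟩, _, ⟨hy, y, rfl⟩, rfl⟩
    exact ⟨Set.add_mem_add hx hy, x + y, by ext i; simp⟩
  rintro ⟨⟨p, hp, o, ho, hpo⟩, z, rfl⟩
  change p + o = latticePoint z at hpo
  change latticePoint z ∈ _
  obtain ⟨W, hW, hWl, hPW⟩ := hP
  obtain ⟨V, hV, hVl, hQV⟩ := hQ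
  have hWP : W ⊆ P := hPW ▸ subset_convexHull ℝ W
  have hWne : W.Nonempty := by
    rw [← convexHull_nonempty_iff (𝕜 := ℝ), ← hPW]
    exact ⟨p, hp⟩
  by_contra hcon
  -- Reflecting `P` turns decompositions of `z` into points of `R ∩ Q`, and maxima over `P` into
  -- minima over `R`.
  set R : Set (Fin 2 → ℝ) := {y | latticePoint z - y ∈ P} with hRdef
  have hR : Convex ℝ R := by
    have hPc : Convex ℝ P := hPW ▸ convex_convexHull ℝ W
    intro x hx y hy s t hs ht hst
    have := hPc hx hy hs ht hst
    simp only [hRdef, Set.mem_ofPred_eq]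
    convert this using 1
    obtain rfl : s = 1 - t := by linarith
    ext i; simp; ring
  have hdisj : ∀ x, latticePoint x ∈ R → latticePoint x ∉ Q := by
    intro x hx hxQ
    refine hcon ⟨latticePoint (z - x), ⟨?_, z - x, rfl⟩, latticePoint x, ⟨hxQ, x, rfl⟩, ?_⟩
    · rw [latticePoint_sub]; exact hx
    · simp [latticePoint_sub]
  have hoR : o ∈ R := by
    simp only [hRdef, Set.mem_ofPred_eq, ← hpo]
    simpa using hp
  have hWR : ∀ x, latticePoint x ∈ W → latticePoint (z - x) ∈ R := by
    intro x hx
    simp only [hRdef, Set.mem_ofPred_eq, latticePoint_sub]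
    simpa using hWP hx
  obtain ⟨a, ha⟩ := hWne
  obtain ⟨a', rfl⟩ := hWl ha
  refine false_of_cuts hR (hQV ▸ convex_convexHull ℝ V) hdisj (fun b hb =>
    exists_cut hV hVl hQV hR hdisj hoR ho ?_ hb) (hWR a' ha)
  intro u q₁ hq₁ q₂ hq₂ hne m₁ m₂
  obtain ⟨p₁, hp₁, p₂, hp₂, hne', n₁, n₂⟩ :=
    hPQ.exists_ne_vertices hW ⟨_, ha⟩ hPW hq₁ hq₂ hne m₁ m₂
  obtain ⟨x₁, rfl⟩ := hWl hp₁
  obtain ⟨x₂, rfl⟩ := hWl hp₂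
  refine ⟨z - x₁, z - x₂, ?_, hWR _ hp₁, hWR _ hp₂, fun y hy => ?_, fun y hy => ?_⟩
  · rintro h
    rw [sub_right_inj] at h
    exact hne' (by rw [h])
  · have := n₁ _ hy
    rw [dotProduct_sub] at this
    rw [latticePoint_sub, dotProduct_sub]
    change _ ≤ u ⬝ᵥ latticePoint x₁ at this
    linarith
  · have := n₂ _ hy
    rw [dotProduct_sub] at this
    rw [latticePoint_sub, dotProduct_sub]
    change _ ≤ u ⬝ᵥ latticePoint x₂ at this
    linarith
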